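/- All graphs are finite, simple and undirected, and $K_m$ denotes the complete graph on $m$ vertices. A partial homomorphism from a graph $G$ to a graph $H$ is a map $h:X\to V(H)$ with $X\subseteq V(G)$ that is a homomorphism from the induced subgraph $G|_X$ to $H$; write $\operatorname{dom}(h)=X$. For an integer $k\ge 0$, a $k$-strategy on $G$ and $H$ is a nonempty family $\mathcal H$ of partial homomorphisms from $G$ to $H$ such that (i) for every $h\in\mathcal H$ and every $X\subseteq\operatorname{dom}(h)$, the restriction $h|_X$ is in $\mathcal H$; and (ii) for every $h\in\mathcal H$ with $|\operatorname{dom}(h)|<k$ and every $x\in V(G)\setminus\operatorname{dom}(h)$, there is $f\in\mathcal H$ that extends $h$ and has $\operatorname{dom}(f)=\operatorname{dom}(h)\cup\{x\}$. Write $G\le_k H$ if there is a $k$-strategy on $G$ and $H$. Write $G\to H$ if there is a homomorphism from $G$ to $H$; thus $G\to K_q$ means that $G$ is properly $q$-colourable. **Theorem.** Fix a real $\epsilon\in(0,1/2)$ and a function $q$ from the non-negative integers to the non-negative integers such that $q(n)\ge 3$ for all $n\ge 1$, and $q(n)=\Theta(n^{\epsilon})$ as $n\to\infty$. The following hold. 1.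 There is a positive-integer-valued function $k(n)=O(n^{1-2\epsilon})$ such that, for every graph $G$, if $G\le_{k(n)}K_3$ then $G\to K_{q(n)}$, where $n$ is the number of vertices of $G$. 2. For every real $\gamma<1-3\epsilon$ and every non-negative-integer-valued function $k(n)=O(n^{\gamma})$, there exist arbitrarily large graphs $G$ such that $G\le_{k(n)}K_3$ and $G\not\to K_{q(n)}$, where $n$ is the number of vertices of $G$. -/

import Mathlib

open Filter Asymptotics

namespace LocalConsistency

variable {V W : Type*}

/-- The domain of a partial map from `V` to `W`, a partial map being coded as a function
`V → Option W` with the value `none` at the points where it is undefined. -/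
def dom (f : V → Option W) : Set V := {v | ∃ a, f v = some a}

/-- `Extends f h` : the partial map `f` extends the partial map `h`, that is, `h ⊆ f`;
equivalently, `h` is the restriction of `f` to a subset of its domain. -/
def Extends (f h : V → Option W) : Prop := ∀ v a, h v = some a → f v = some a

/-- `f` is a partial homomorphism from `G` to `H`: a homomorphism to `H` from the subgraph of
`G` induced by the domain of `f`. -/
def IsPartialHom (G : SimpleGraph V) (H : SimpleGraph W) (f : V → Option W) : Prop :=
  ∀ u v a b, f u = some a → f v = some b → G.Adj u v → H.Adj a b

/-- A `k`-strategy on `G` and `H`: a nonempty family of partial homomorphisms from `G` to `H`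
that is closed under restrictions and has the extension property up to `k`. -/
structure IsStrategy (k : ℕ) (G : SimpleGraph V) (H : SimpleGraph W)
    (S : Set (V → Option W)) : Prop where
  nonempty : S.Nonempty
  isPartialHom : ∀ h ∈ S, IsPartialHom G H h
  restrict : ∀ h ∈ S, ∀ g, Extends h g → g ∈ S
  extend : ∀ h ∈ S, (dom h).encard < k → ∀ x ∉ dom h,
    ∃ f ∈ S, Extends f h ∧ dom f = insert x (dom h)

/-- `G ≤_k H`: there is a `k`-strategy on `G` and `H`. -/
def ConsistentLE (k : ℕ) (G : SimpleGraph V) (H : SimpleGraph W) : Prop :=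
  ∃ S : Set (V → Option W), IsStrategy k G H S

end LocalConsistency

/-! Upper bound: let `m` be about `q n / 4`. A greedily chosen set `T` of at most `n / m` vertices
leaves every vertex with fewer than `m` neighbours outside `N(T)`, so the complement of `N(T)` is
greedily `m`-colourable. Split `T` into `m` groups of about `n / m ^ 2` vertices. Once a strategy
has coloured one group, each neighbour of the group has at most two colours left, and the remaining
consistency solves this 2-SAT-like problem: the neighbourhood of each group is 3-colourable
(`exists_colouring_of_neighbours`). In total `3 * m + m` colours suffice (`ConsistentLE.colorable`).

Lower bound: take about `n ^ (1 + ε + δ)` random arcs. A union bound leaves no independent set of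
size about `n ^ (1 - ε)`, hence no `q n`-colouring, while every set of `O(n ^ γ)` vertices has
average degree at most `3 - 2 * δ` (`exists_sparse_graph`). Minimal obstructions to extending a
3-colouring have inner degrees at least 3, so sparsity makes them small; the partial colourings that
meet no small obstruction form a strategy (`LocallySparse.consistentLE`). -/

namespace LocalConsistency

universe u

/-! ### Path consistency inside a strategy -/

section Strategies

variable {V W : Type*} {k : ℕ} {G : SimpleGraph V} {H : SimpleGraph W} {S : Set (V → Option W)}

theorem IsStrategy.exists_dom_eq (hS : IsStrategy k G H S) (s : Finset V) (hs : s.card ≤ k) :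
    ∃ f ∈ S, dom f = (s : Set V) := by
  classical
  induction s using Finset.induction_on with
  | empty =>
    obtain ⟨h, hh⟩ := hS.nonempty
    refine ⟨fun _ => none, hS.restrict h hh _ (by intro v a h; simp at h), ?_⟩
    ext v
    simp [dom]
  | insert x s hx ih =>
    rw [Finset.card_insert_of_notMem hx] at hs
    obtain ⟨f, hf, hd⟩ := ih (by omega)
    obtain ⟨g, hg, -, hgd⟩ := hS.extend f hf
      (by rw [hd, Set.encard_coe_eq_coe_finsetCard]; exact_mod_cast hs) x (by simpa [hd] using hx)
    exact ⟨g, hg, by rw [hgd, hd, Finset.coe_insert]⟩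

/-- Some member of `S` extends `h` and maps `x` to `a` and `y` to `b`. -/
def CompatiblePair (S : Set (V → Option W)) (h : V → Option W) (x : V) (a : W) (y : V) (b : W) :
    Prop :=
  ∃ g ∈ S, Extends g h ∧ g x = some a ∧ g y = some b

/-- Restricting the witness to `dom h ∪ {x, y}` frees the room needed to extend it to `z`; this is
why two spare pebbles, with strict inequality, are required. -/
theorem IsStrategy.exists_compatiblePair (hS : IsStrategy k G H S) {h : V → Option W}
    (hk : (dom h).encard + 2 < k) {x y : V} {a b : W} (hab : CompatiblePair S h x a y b) (z : V) :
    ∃ c, CompatiblePair S h x a z c ∧ CompatiblePair S h y b z c := by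
  classical
  obtain ⟨g, hg, hgh, hx, hy⟩ := hab
  set g' : V → Option W := fun v => if v ∈ dom h ∪ {x, y} then g v else none with hg'
  have hS' : g' ∈ S := hS.restrict g hg g' (by
    intro v c hv
    by_cases hvd : v ∈ dom h ∪ {x, y}
    · rw [hg'] at hv
      simpa only [if_pos hvd] using hv
    · rw [hg'] at hv
      simp only [if_neg hvd] at hv
      cases hv)
  have hext : Extends g' h := by
    intro v c hv
    have hvd : v ∈ dom h ∪ {x, y} := Or.inl ⟨c, hv⟩
    rw [hg']
    simp only [if_pos hvd]
    exact hgh v c hv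
  have hx' : g' x = some a := by simp [hg', hx]
  have hy' : g' y = some b := by simp [hg', hy]
  have hcard : (dom g').encard < k := by
    refine lt_of_le_of_lt ?_ hk
    refine (Set.encard_le_encard (t := dom h ∪ {x, y}) ?_).trans
      ((Set.encard_union_le _ _).trans ?_)
    · rintro v ⟨c, hc⟩
      by_contra hv
      simp only [hg', if_neg hv] at hc
      cases hc
    · gcongr
      refine (Set.encard_insert_le _ _).trans ?_
      rw [Set.encard_singleton, one_add_one_eq_two]
  by_cases hz : z ∈ dom g'
  · obtain ⟨c, hc⟩ := hz
    exact ⟨c, ⟨g', hS', hext, hx', hc⟩, ⟨g', hS', hext, hy', hc⟩⟩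
  · obtain ⟨f, hf, hfg, hfd⟩ := hS.extend g' hS' hcard z hz
    obtain ⟨c, hc⟩ : z ∈ dom f := by rw [hfd]; exact Set.mem_insert _ _
    have hfh : Extends f h := fun v a hv => hfg v a (hext v a hv)
    exact ⟨c, ⟨f, hf, hfh, hfg _ _ hx', hc⟩, ⟨f, hf, hfh, hfg _ _ hy', hc⟩⟩

theorem CompatiblePair.symm {h : V → Option W} {x y : V} {a b : W}
    (hab : CompatiblePair S h x a y b) : CompatiblePair S h y b x a := by
  obtain ⟨g, hg, hgh, hx, hy⟩ := hab
  exact ⟨g, hg, hgh, hy, hx⟩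

theorem CompatiblePair.right {h : V → Option W} {x y : V} {a b : W}
    (hab : CompatiblePair S h x a y b) : CompatiblePair S h y b y b := by
  obtain ⟨g, hg, hgh, hx, hy⟩ := hab
  exact ⟨g, hg, hgh, hy, hy⟩

end Strategies

/-! ### Three-colouring the neighbourhood of a small set -/

section ThreeColours

variable {V : Type*} {k : ℕ} {G : SimpleGraph V} {S : Set (V → Option (Fin 3))}

/-- With `h` fixed, every vertex of `s` has a two-element list of colours, and for such lists
pairwise compatibility can be maintained while vertices are added one at a time. -/
theorem exists_pairwise_compatible (hS : IsStrategy k G (SimpleGraph.completeGraph (Fin 3)) S)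
    {h : V → Option (Fin 3)} (hh : h ∈ S) (hk : (dom h).encard + 2 < k) (s : Finset V)
    (hs : ∀ z ∈ s, ∃ t ∈ dom h, G.Adj t z) :
    ∃ f : V → Fin 3, ∀ x ∈ s, ∀ y ∈ s, CompatiblePair S h x (f x) y (f y) := by
  classical
  induction s using Finset.induction_on with
  | empty => exact ⟨fun _ => 0, by simp⟩
  | insert z s hz ih =>
    obtain ⟨f, hf⟩ := ih fun z hz => hs z (Finset.mem_insert_of_mem hz)
    obtain ⟨t, ⟨a, ha⟩, htz⟩ := hs z (Finset.mem_insert_self _ _)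
    -- the pairs already fixed, together with a coloured neighbour of `z`
    let P : Set (V × Fin 3) := insert (t, a) ((fun x => (x, f x)) '' (s : Set V))
    have hP : ∀ p ∈ P, ∀ r ∈ P, CompatiblePair S h p.1 p.2 r.1 r.2 := by
      rintro p (rfl | ⟨x, hx, rfl⟩) r (rfl | ⟨y, hy, rfl⟩)
      · exact ⟨h, hh, fun _ _ h => h, ha, ha⟩
      · obtain ⟨g, hg, hgh, h1, -⟩ := hf y hy y hy
        exact ⟨g, hg, hgh, hgh _ _ ha, h1⟩
      · obtain ⟨g, hg, hgh, h1, -⟩ := hf x hx x hx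
        exact ⟨g, hg, hgh, h1, hgh _ _ ha⟩
      · exact hf x hx y hy
    have hne : ∀ p : V × Fin 3, ∀ c, CompatiblePair S h p.1 p.2 z c → c ≠ a := by
      rintro p c ⟨g, hg, hgh, -, h1⟩ rfl
      exact hS.isPartialHom g hg t z c c (hgh _ _ ha) h1 htz rfl
    -- Only `a + 1` and `a + 2` are possible at `z`. If `p` excluded one and `r` the other, the
    -- compatible pair `p`, `r` would have no common extension to `z`.
    have key : ∃ c, ∀ p ∈ P, CompatiblePair S h p.1 p.2 z c := by
      by_contra! hcon
      obtain ⟨p, hp, hp'⟩ := hcon (a + 1)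
      obtain ⟨r, hr, hr'⟩ := hcon (a + 2)
      obtain ⟨c, hc1, hc2⟩ := hS.exists_compatiblePair hk (hP p hp r hr) z
      have h0 := hne p c hc1
      have h1 : c ≠ a + 1 := by rintro rfl; exact hp' hc1
      have h2 : c ≠ a + 2 := by rintro rfl; exact hr' hc2
      clear * - h0 h1 h2
      revert h0 h1 h2
      revert a c
      decide
    obtain ⟨c, hc⟩ := key
    have hzc : CompatiblePair S h z c z c := (hc (t, a) (Set.mem_insert _ _)).right
    have hxc : ∀ x ∈ s, CompatiblePair S h x (f x) z c := fun x hx =>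
      hc (x, f x) (Set.mem_insert_of_mem _ ⟨x, hx, rfl⟩)
    refine ⟨Function.update f z c, ?_⟩
    have hupd : ∀ x ∈ s, Function.update f z c x = f x := by
      intro x hx
      exact Function.update_of_ne (by rintro rfl; exact hz hx) _ _
    intro x hx y hy
    rcases Finset.mem_insert.1 hx with hxz | hx' <;>
      rcases Finset.mem_insert.1 hy with hyz | hy'
    · simpa [hxz, hyz] using hzc
    · simpa [hxz, hupd y hy'] using (hxc y hy').symm
    · simpa [hyz, hupd x hx'] using hxc x hx'
    · simpa [hupd x hx', hupd y hy'] using hf x hx' y hy'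

/-- The union of the neighbourhoods of fewer than `k - 2` vertices is 3-colourable. -/
theorem exists_colouring_of_neighbours
    (hS : IsStrategy k G (SimpleGraph.completeGraph (Fin 3)) S) (T s : Finset V)
    (hT : T.card + 2 < k) (hs : ∀ z ∈ s, ∃ t ∈ T, G.Adj t z) :
    ∃ f : V → Fin 3, ∀ x ∈ s, ∀ y ∈ s, G.Adj x y → f x ≠ f y := by
  obtain ⟨h, hh, hd⟩ := hS.exists_dom_eq T (by omega)
  obtain ⟨f, hf⟩ := exists_pairwise_compatible hS hh
    (by rw [hd, Set.encard_coe_eq_coe_finsetCard]; exact_mod_cast hT) s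
    (fun z hz => by simpa [hd] using hs z hz)
  refine ⟨f, fun x hx y hy hxy => ?_⟩
  obtain ⟨g, hg, -, h1, h2⟩ := hf x hx y hy
  exact hS.isPartialHom g hg x y _ _ h1 h2 hxy

end ThreeColours

/-! ### From local 3-colourability to a global colouring -/

section Colouring

variable {V : Type*} (G : SimpleGraph V)

theorem exists_greedy_colouring [DecidableEq V] [DecidableRel G.Adj] {m : ℕ} (hm : 0 < m)
    (s : Finset V) (hs : ∀ v ∈ s, (s.filter (G.Adj v)).card < m) :
    ∃ f : V → Fin m, ∀ x ∈ s, ∀ y ∈ s, G.Adj x y → f x ≠ f y := by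
  induction s using Finset.induction_on with
  | empty => exact ⟨fun _ => ⟨0, hm⟩, by simp⟩
  | insert z s hz ih =>
    obtain ⟨f, hf⟩ := ih fun v hv => lt_of_le_of_lt
      (Finset.card_le_card (Finset.filter_subset_filter _ (Finset.subset_insert _ _)))
      (hs v (Finset.mem_insert_of_mem hv))
    obtain ⟨c, -, hc⟩ := Finset.exists_mem_notMem_of_card_lt_card
      (s := ((insert z s).filter (G.Adj z)).image f) (t := Finset.univ)
      (by
        rw [Finset.card_univ, Fintype.card_fin]
        exact Finset.card_image_le.trans_lt (hs z (Finset.mem_insert_self _ _)))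
    have hc' : ∀ x ∈ s, G.Adj z x → f x ≠ c := by
      rintro x hx hzx rfl
      exact hc (Finset.mem_image_of_mem _ (by simp [hx, hzx]))
    have hupd : ∀ x ∈ s, Function.update f z c x = f x := by
      intro x hx
      exact Function.update_of_ne (by rintro rfl; exact hz hx) _ _
    refine ⟨Function.update f z c, ?_⟩
    intro x hx y hy hxy
    rcases Finset.mem_insert.1 hx with hxz | hx' <;>
      rcases Finset.mem_insert.1 hy with hyz | hy'
    · exact (G.irrefl (hxz ▸ hyz ▸ hxy)).elim
    · simpa [hxz, hupd y hy'] using (hc' y hy' (hxz ▸ hxy)).symm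
    · simpa [hyz, hupd x hx'] using hc' x hx' (hyz ▸ hxy.symm)
    · simpa [hupd x hx', hupd y hy'] using hf x hx' y hy' hxy

/-- Take `T` of maximal size among the sets with at least `m * |T|` neighbours: a vertex with `m`
uncovered neighbours could be added to it. -/
theorem exists_partly_dominating_set [Fintype V] [DecidableEq V] [DecidableRel G.Adj] {m : ℕ}
    (hm : 0 < m) :
    ∃ T : Finset V, T.card * m ≤ Fintype.card V ∧
      ∀ v, (Finset.univ.filter fun w => G.Adj v w ∧ ∀ t ∈ T, ¬ G.Adj t w).card < m := by
  let N : Finset V → Finset V := fun T => Finset.univ.filter fun w => ∃ t ∈ T, G.Adj t w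
  obtain ⟨T, hT, hmax⟩ := Finset.exists_max_image
    (Finset.univ.filter fun T : Finset V => T.card * m ≤ (N T).card) Finset.card
    ⟨∅, by simp⟩
  simp only [Finset.mem_filter, Finset.mem_univ, true_and] at hT hmax
  refine ⟨T, hT.trans (Finset.card_le_univ _), fun v => ?_⟩
  by_contra! hv
  set A := Finset.univ.filter fun w => G.Adj v w ∧ ∀ t ∈ T, ¬ G.Adj t w with hA
  have hvT : v ∉ T := by
    intro hvT
    obtain ⟨w, hw⟩ := Finset.card_pos.1 (hm.trans_le hv)
    simp only [hA, Finset.mem_filter, Finset.mem_univ, true_and] at hw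
    exact hw.2 v hvT hw.1
  have hdisj : Disjoint (N T) A := by
    rw [Finset.disjoint_left]
    intro w hw hwA
    simp only [N, hA, Finset.mem_filter, Finset.mem_univ, true_and] at hw hwA
    obtain ⟨t, ht, htw⟩ := hw
    exact hwA.2 t ht htw
  have hsub : N T ∪ A ⊆ N (insert v T) := by
    intro w hw
    simp only [N, hA, Finset.mem_union, Finset.mem_filter, Finset.mem_univ, true_and] at hw ⊢
    rcases hw with ⟨t, ht, htw⟩ | hw
    · exact ⟨t, Finset.mem_insert_of_mem ht, htw⟩
    · exact ⟨v, Finset.mem_insert_self _ _, hw.1⟩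
  have hcard := Finset.card_le_card hsub
  rw [Finset.card_union_of_disjoint hdisj] at hcard
  have := hmax (insert v T) (by rw [Finset.card_insert_of_notMem hvT, add_mul, one_mul]; omega)
  rw [Finset.card_insert_of_notMem hvT] at this
  omega

theorem exists_equitable_grouping (T : Finset V) [DecidableEq V] {b m : ℕ} (hm : 0 < m)
    (hb : 0 < b) (hT : T.card ≤ b * m) :
    ∃ g : V → Fin m, ∀ i, (T.filter fun t => g t = i).card ≤ b := by
  classical
  let e := T.equivFin
  have hlt : ∀ t : T, (e t : ℕ) / b < m := fun t =>
    Nat.div_lt_of_lt_mul ((e t).2.trans_le hT)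
  -- Number the elements of `T`: the quotient by `b` names the group, and the remainder is injective
  -- on each group.
  refine ⟨fun v => if h : v ∈ T then ⟨e ⟨v, h⟩ / b, hlt _⟩ else ⟨0, hm⟩, fun i => ?_⟩
  refine (?_ : _ ≤ (Finset.range b).card).trans_eq (Finset.card_range b)
  refine Finset.card_le_card_of_injOn (fun v => if h : v ∈ T then (e ⟨v, h⟩ : ℕ) % b else 0) ?_ ?_
  · intro v hv
    simp only [Finset.coe_filter, Set.mem_ofPred_eq] at hv
    simp only [dif_pos hv.1, Finset.coe_range, Set.mem_Iio]
    exact Nat.mod_lt _ hb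
  · intro v hv w hw hvw
    simp only [Finset.coe_filter, Set.mem_ofPred_eq] at hv hw
    have h1 := hv.2
    have h2 := hw.2
    simp only [dif_pos hv.1, dif_pos hw.1] at h1 h2 hvw
    have h3 : (e ⟨v, hv.1⟩ : ℕ) / b = (e ⟨w, hw.1⟩ : ℕ) / b :=
      congrArg Fin.val (h1.trans h2.symm)
    have h4 : (e ⟨v, hv.1⟩ : ℕ) = (e ⟨w, hw.1⟩ : ℕ) := by
      rw [← Nat.div_add_mod (e ⟨v, hv.1⟩ : ℕ) b, ← Nat.div_add_mod (e ⟨w, hw.1⟩ : ℕ) b, h3, hvw]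
    have h5 := e.injective (Fin.ext h4)
    exact congrArg Subtype.val h5

/-- Local 3-colourability with about `n / m ^ 2` pebbles yields a colouring with `4 m` colours. -/
theorem ConsistentLE.colorable [Fintype V] {k b m : ℕ} (hm : 0 < m) (hb : 0 < b)
    (hbm : Fintype.card V ≤ b * m * m) (hk : b + 2 < k)
    (hG : ConsistentLE k G (SimpleGraph.completeGraph (Fin 3))) : G.Colorable (4 * m) := by
  classical
  obtain ⟨S, hS⟩ := hG
  obtain ⟨T, hT, hdeg⟩ := exists_partly_dominating_set G hm
  obtain ⟨grp, hgrp⟩ := exists_equitable_grouping T hm hb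
    (Nat.le_of_mul_le_mul_right (hT.trans hbm) hm)
  have hcol : ∀ i : Fin m, ∃ f : V → Fin 3, ∀ x y, (∃ t ∈ T, grp t = i ∧ G.Adj t x) →
      (∃ t ∈ T, grp t = i ∧ G.Adj t y) → G.Adj x y → f x ≠ f y := by
    intro i
    obtain ⟨f, hf⟩ := exists_colouring_of_neighbours hS (T.filter fun t => grp t = i)
      (Finset.univ.filter fun z => ∃ t ∈ T, grp t = i ∧ G.Adj t z)
      (by have := hgrp i; omega) (by
        intro z hz
        simp only [Finset.mem_filter, Finset.mem_univ, true_and] at hz ⊢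
        obtain ⟨t, h1, h2, h3⟩ := hz
        exact ⟨t, ⟨h1, h2⟩, h3⟩)
    exact ⟨f, fun x y hx hy => hf x (by simpa using hx) y (by simpa using hy)⟩
  choose f hf using hcol
  obtain ⟨g, hg⟩ := exists_greedy_colouring G hm
    (Finset.univ.filter fun w => ∀ t ∈ T, ¬ G.Adj t w) (by
      intro v _
      rw [Finset.filter_filter]
      simpa only [and_comm] using hdeg v)
  -- A covered vertex records the group of one chosen neighbour in `T` and its colour there;
  -- uncovered vertices use a separate palette.
  let col : V → Fin m × Fin 3 ⊕ Fin m := fun w =>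
    if h : ∃ t ∈ T, G.Adj t w then .inl (grp h.choose, f (grp h.choose) w) else .inr (g w)
  have hval : ∀ {v w : V}, G.Adj v w → col v ≠ col w := by
    intro v w hvw heq
    by_cases hv : ∃ t ∈ T, G.Adj t v <;> by_cases hw : ∃ t ∈ T, G.Adj t w
    · simp only [col, dif_pos hv, dif_pos hw, Sum.inl.injEq, Prod.mk.injEq] at heq
      obtain ⟨h1, h2⟩ := heq
      refine hf (grp hv.choose) v w ⟨_, hv.choose_spec.1, rfl, hv.choose_spec.2⟩
        ⟨_, hw.choose_spec.1, h1.symm, hw.choose_spec.2⟩ hvw ?_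
      rw [h2, h1]
    · simp [col, dif_pos hv, dif_neg hw] at heq
    · simp [col, dif_neg hv, dif_pos hw] at heq
    · simp only [col, dif_neg hv, dif_neg hw, Sum.inr.injEq] at heq
      exact hg v (by simpa using hv) w (by simpa using hw) hvw heq
  have := (SimpleGraph.Coloring.mk col hval).colorable
  refine this.mono (le_of_eq ?_)
  simp only [Fintype.card_sum, Fintype.card_prod, Fintype.card_fin]
  ring

theorem ConsistentLE.colorable_of_card_le [Fintype V] {k : ℕ} (hk : Fintype.card V ≤ k)
    (hG : ConsistentLE k G (SimpleGraph.completeGraph (Fin 3))) : G.Colorable 3 := by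
  obtain ⟨S, hS⟩ := hG
  obtain ⟨f, hf, hd⟩ := hS.exists_dom_eq Finset.univ hk
  have hdef : ∀ v, ∃ a, f v = some a := fun v => by
    have : v ∈ dom f := by rw [hd]; simp
    exact this
  choose g hg using hdef
  exact ⟨SimpleGraph.Coloring.mk g fun {v w} hvw =>
    hS.isPartialHom f hf v w _ _ (hg v) (hg w) hvw⟩

end Colouring

theorem exists_pebble_number (ε : ℝ) (hε1 : ε < 1 / 2) (q : ℕ → ℕ) (hq3 : ∀ n, 1 ≤ n → 3 ≤ q n)
    (hε0 : 0 < ε) (hqΘ : (fun n : ℕ => (n : ℝ) ^ ε) =O[atTop] (fun n => (q n : ℝ))) :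
    ∃ k : ℕ → ℕ, (∀ n, 1 ≤ k n) ∧
      (fun n => (k n : ℝ)) =O[atTop] (fun n : ℕ => (n : ℝ) ^ (1 - 2 * ε)) ∧
      ∀ (V : Type u) [Fintype V] (G : SimpleGraph V),
        ConsistentLE (k (Fintype.card V)) G (SimpleGraph.completeGraph (Fin 3)) →
        G.Colorable (q (Fintype.card V)) := by
  -- Here `m = q n / 4` and `b = n / m ^ 2 + 1`, so `+ 4` gives `b + 2 < k`. When `q n < 4` there is
  -- no positive `m`; then `n + 1` pebbles colour the whole graph, and this happens only finitely
  -- often.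
  refine ⟨fun n => if q n < 4 then n + 1 else n / (q n / 4) ^ 2 + 4, ?_, ?_, ?_⟩
  · intro n
    dsimp only
    split_ifs
    exacts [Nat.le_add_left _ _, Nat.le_add_left 1 (_ + 3)]
  · obtain ⟨C, hC0, hC⟩ := hqΘ.exists_pos
    rw [IsBigOWith] at hC
    have hlarge : ∀ᶠ n : ℕ in atTop, 4 * C ≤ (n : ℝ) ^ ε :=
      ((tendsto_rpow_atTop hε0).comp tendsto_natCast_atTop_atTop).eventually_ge_atTop _
    refine IsBigO.of_bound (64 * C ^ 2 + 4) ?_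
    filter_upwards [hC, hlarge, eventually_ge_atTop 1] with n hn hln hn1
    have hn0 : (1 : ℝ) ≤ n := by exact_mod_cast hn1
    have hpos : (0 : ℝ) < n := by linarith
    have hx : 0 < (n : ℝ) ^ ε := Real.rpow_pos_of_pos hpos _
    rw [Real.norm_of_nonneg hx.le, Real.norm_of_nonneg (Nat.cast_nonneg _)] at hn
    have hq4 : 4 ≤ q n := by
      have : 4 * C ≤ q n * C := by linarith
      have := le_of_mul_le_mul_right this hC0
      exact_mod_cast this
    rw [if_neg (by omega), Real.norm_of_nonneg (Nat.cast_nonneg _),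
      Real.norm_of_nonneg (Real.rpow_nonneg hpos.le _)]
    set m := q n / 4 with hm
    have hm8 : (q n : ℝ) ≤ 8 * m := by
      have : q n ≤ 8 * m := by omega
      exact_mod_cast this
    have hm0 : (0 : ℝ) < m := by
      have : 0 < m := by omega
      exact_mod_cast this
    have hxm : (n : ℝ) ^ ε ≤ 8 * C * m := by nlinarith
    have h1 : (1 : ℝ) ≤ (n : ℝ) ^ (1 - 2 * ε) := Real.one_le_rpow hn0 (by linarith)
    have h2 : (n : ℝ) = (n : ℝ) ^ (1 - 2 * ε) * ((n : ℝ) ^ ε) ^ 2 := by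
      rw [← Real.rpow_natCast ((n : ℝ) ^ ε) 2, ← Real.rpow_mul hpos.le, ← Real.rpow_add hpos]
      push_cast
      rw [show 1 - 2 * ε + ε * 2 = 1 by ring, Real.rpow_one]
    push_cast
    have h3 : ((n / m ^ 2 : ℕ) : ℝ) ≤ n / (m : ℝ) ^ 2 := by
      have := @Nat.cast_div_le ℝ _ _ _ n (m ^ 2)
      push_cast at this
      exact this
    have h4 : (n : ℝ) / (m : ℝ) ^ 2 ≤ 64 * C ^ 2 * (n : ℝ) ^ (1 - 2 * ε) := by
      rw [div_le_iff₀ (by positivity)]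
      calc (n : ℝ) = (n : ℝ) ^ (1 - 2 * ε) * ((n : ℝ) ^ ε) ^ 2 := h2
        _ ≤ (n : ℝ) ^ (1 - 2 * ε) * (8 * C * m) ^ 2 := by gcongr
        _ = _ := by ring
    linarith
  · intro V _ G hG
    dsimp only at hG
    rcases Nat.eq_zero_or_pos (Fintype.card V) with h0 | hpos
    · have := Fintype.card_eq_zero_iff.1 h0
      exact ⟨SimpleGraph.Coloring.ofIsEmpty⟩
    · split_ifs at hG with h4
      · exact (hG.colorable_of_card_le G (by omega)).mono (hq3 _ hpos)
      · set n := Fintype.card V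
        refine (hG.colorable G (b := n / (q n / 4) ^ 2 + 1) (m := q n / 4) (by omega)
          (Nat.succ_pos _) ?_ (Nat.lt_succ_self _)).mono (by omega)
        have hm : 0 < (q n / 4) ^ 2 := by
          have : 0 < q n / 4 := by omega
          positivity
        have := Nat.lt_div_mul_add (a := n) hm
        calc n ≤ n / (q n / 4) ^ 2 * (q n / 4) ^ 2 + (q n / 4) ^ 2 := this.le
          _ = _ := by ring

end LocalConsistency

namespace LocalConsistency

section Sparse

variable {V : Type*} [DecidableEq V] (G : SimpleGraph V)

/-- The colouring of `X` by `g` extends to a proper 3-colouring of `X ∪ Y`. -/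
def ExtendsOver (g : V → Fin 3) (X Y : Finset V) : Prop :=
  ∃ f : V → Fin 3, (∀ x ∈ X, f x = g x) ∧ ∀ u ∈ X ∪ Y, ∀ v ∈ X ∪ Y, G.Adj u v → f u ≠ f v

/-- Every set `Y` of at most `L` vertices spans at most `θ / 2 * |Y|` edges. -/
def LocallySparse [DecidableRel G.Adj] (L : ℕ) (θ : ℝ) : Prop :=
  ∀ Y : Finset V, Y.card ≤ L → (∑ y ∈ Y, ((Y.filter (G.Adj y)).card : ℝ)) ≤ θ * Y.card

variable {G}

/-- A vertex with at most two neighbours can be coloured last. -/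
theorem ExtendsOver.of_erase [DecidableRel G.Adj] {g : V → Fin 3} {X Y : Finset V} {y : V}
    (hyY : y ∈ Y) (h : ExtendsOver G g X (Y.erase y))
    (hy : y ∈ X ∨ ((X ∪ Y).filter (G.Adj y)).card < 3) : ExtendsOver G g X Y := by
  obtain ⟨f, hfg, hf⟩ := h
  have hmem : ∀ u ∈ X ∪ Y, u ≠ y → u ∈ X ∪ Y.erase y := by
    intro u hu huy
    simp only [Finset.mem_union, Finset.mem_erase] at hu ⊢
    tauto
  by_cases hyX : y ∈ X
  · refine ⟨f, hfg, fun u hu v hv => hf u ?_ v ?_⟩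
    · by_cases h : u = y
      · exact Finset.mem_union_left _ (h ▸ hyX)
      · exact hmem u hu h
    · by_cases h : v = y
      · exact Finset.mem_union_left _ (h ▸ hyX)
      · exact hmem v hv h
  · have hy3 := hy.resolve_left hyX
    obtain ⟨c, -, hc⟩ := Finset.exists_mem_notMem_of_card_lt_card
      (s := ((X ∪ Y).filter (G.Adj y)).image f) (t := Finset.univ)
      (by
        rw [Finset.card_univ, Fintype.card_fin]
        exact Finset.card_image_le.trans_lt hy3)
    have hc' : ∀ x ∈ X ∪ Y, G.Adj y x → f x ≠ c := by
      rintro x hx hyx rfl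
      exact hc (Finset.mem_image_of_mem _ (Finset.mem_filter.2 ⟨hx, hyx⟩))
    refine ⟨Function.update f y c, ?_, ?_⟩
    · intro x hx
      rw [Function.update_of_ne (by rintro rfl; exact hyX hx)]
      exact hfg x hx
    · intro u hu v hv huv
      by_cases h1 : u = y <;> by_cases h2 : v = y
      · subst h1 h2
        exact (G.irrefl huv).elim
      · subst h1
        simpa [Function.update_of_ne h2] using (hc' v hv huv).symm
      · subst h2
        simpa [Function.update_of_ne h1] using hc' u hu huv.symm
      · simpa [Function.update_of_ne h1, Function.update_of_ne h2] using
          hf u (hmem u hu h1) v (hmem v hv h2) huv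

/-- In a locally sparse graph an obstruction to extending a colouring of `X` can be taken of size
linear in `|X|`. -/
theorem LocallySparse.exists_small_obstruction [DecidableRel G.Adj] {L : ℕ} {θ : ℝ}
    (hG : LocallySparse G L θ) (hθ : θ ≤ 3) {g : V → Fin 3} {X : Finset V} (Y : Finset V)
    (hL : X.card + Y.card ≤ L) (hY : ¬ ExtendsOver G g X Y) :
    ∃ Z : Finset V, (3 - θ) * Z.card ≤ 3 * X.card ∧ ¬ ExtendsOver G g X Z := by
  induction Y using Finset.strongInduction with
  | H Y ih =>
    by_cases hmin : ∃ y ∈ Y, ¬ ExtendsOver G g X (Y.erase y)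
    · obtain ⟨y, hy, hyY⟩ := hmin
      exact ih _ (Finset.erase_ssubset hy)
        (by have := Finset.card_le_card (Finset.erase_subset y Y); omega) hyY
    · push Not at hmin
      refine ⟨Y, ?_, hY⟩
      have hdeg : ∀ y ∈ Y, y ∉ X ∧ 3 ≤ ((X ∪ Y).filter (G.Adj y)).card := by
        intro y hy
        by_contra hcon
        exact hY ((hmin y hy).of_erase hy (by rw [not_and_or, not_not, not_le] at hcon; exact hcon))
      have hdisj : Disjoint X Y := Finset.disjoint_right.2 fun y hy => (hdeg y hy).1
      have hcard := Finset.card_union_of_disjoint hdisj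
      have hs := hG (X ∪ Y) (by omega)
      -- For a minimal obstruction, `3 * |Y|` is at most the degree sum on `X ∪ Y`, which sparsity
      -- bounds by `θ * (|X| + |Y|)`.
      have h3 : (3 : ℝ) * Y.card ≤ ∑ y ∈ X ∪ Y, (((X ∪ Y).filter (G.Adj y)).card : ℝ) := by
        calc (3 : ℝ) * Y.card = ∑ y ∈ Y, (3 : ℝ) := by rw [Finset.sum_const, nsmul_eq_mul]; ring
          _ ≤ ∑ y ∈ Y, (((X ∪ Y).filter (G.Adj y)).card : ℝ) :=
            Finset.sum_le_sum fun y hy => by exact_mod_cast (hdeg y hy).2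
          _ ≤ _ := Finset.sum_le_sum_of_subset_of_nonneg Finset.subset_union_right
            fun _ _ _ => Nat.cast_nonneg _
      rw [hcard] at hs
      push_cast at hs
      have : (0 : ℝ) ≤ X.card := Nat.cast_nonneg _
      nlinarith

/-- The restriction of a total map to a finite set, as a partial map. -/
def restrictTo (g : V → Fin 3) (X : Finset V) : V → Option (Fin 3) :=
  fun v => if v ∈ X then some (g v) else none

theorem restrictTo_eq_some {g : V → Fin 3} {X : Finset V} {v : V} {a : Fin 3} :
    restrictTo g X v = some a ↔ v ∈ X ∧ g v = a := by
  unfold restrictTo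
  split_ifs with h <;> simp [h]

theorem dom_restrictTo (g : V → Fin 3) (X : Finset V) : dom (restrictTo g X) = (X : Set V) := by
  ext v
  simp [dom, restrictTo_eq_some]

/-- The strategy consists of the colourings of at most `k` vertices that extend over every set of
size `3 * M + 1`. By sparsity any obstruction within range shrinks to size `M`; the bound `3 * M +
1` makes room for a new vertex and one obstruction for each of its three colours. -/
theorem LocallySparse.consistentLE [DecidableRel G.Adj] {L M k : ℕ} {θ : ℝ}
    (hG : LocallySparse G L θ) (hθ : θ < 3) (hM : 3 * (k : ℝ) ≤ (3 - θ) * M)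
    (hL : 3 * M + 1 + k ≤ L) : ConsistentLE k G (SimpleGraph.completeGraph (Fin 3)) := by
  refine ⟨{h | ∃ g X, h = restrictTo g X ∧ X.card ≤ k ∧
    ∀ Y : Finset V, Y.card ≤ 3 * M + 1 → ExtendsOver G g X Y}, ?_, ?_, ?_, ?_⟩
  · refine ⟨_, fun _ => 0, ∅, rfl, by simp, fun Y hY => ?_⟩
    by_contra hcon
    obtain ⟨Z, hZ, hZ'⟩ := hG.exists_small_obstruction hθ.le Y (by simp; omega) hcon
    have : (Z.card : ℝ) ≤ 0 := by
      simp only [Finset.card_empty, Nat.cast_zero, mul_zero] at hZ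
      nlinarith
    have hZ0 : Z = ∅ := Finset.card_eq_zero.1 (by exact_mod_cast this.antisymm (Nat.cast_nonneg _))
    exact hZ' ⟨fun _ => 0, by simp, by simp [hZ0]⟩
  · rintro h ⟨g, X, rfl, -, hX⟩ u v a b hu hv huv
    obtain ⟨f, hfg, hf⟩ := hX ∅ (by simp)
    rw [restrictTo_eq_some] at hu hv
    have := hf u (Finset.mem_union_left _ hu.1) v (Finset.mem_union_left _ hv.1) huv
    rw [hfg u hu.1, hfg v hv.1, hu.2, hv.2] at this
    exact this
  · rintro h ⟨g, X, rfl, hk, hX⟩ g' hg'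
    refine ⟨g, X.filter fun v => g' v ≠ none, ?_, ?_, ?_⟩
    · funext v
      cases hv : g' v with
      | none =>
        symm
        simp [restrictTo, hv]
      | some a =>
        have := restrictTo_eq_some.1 (hg' v a hv)
        symm
        rw [restrictTo_eq_some]
        simp [this, hv]
    · exact (Finset.card_filter_le _ _).trans hk
    · intro Y hY
      obtain ⟨f, hfg, hf⟩ := hX Y hY
      have hsub : (X.filter fun v => g' v ≠ none) ∪ Y ⊆ X ∪ Y :=
        Finset.union_subset_union (Finset.filter_subset _ _) subset_rfl
      exact ⟨f, fun x hx => hfg x (Finset.mem_of_mem_filter x hx),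
        fun u hu v hv => hf u (hsub hu) v (hsub hv)⟩
  · rintro h ⟨g, X, rfl, -, hX⟩ hlt x hx
    rw [dom_restrictTo] at hx hlt
    rw [Set.encard_coe_eq_coe_finsetCard] at hlt
    have hXk : X.card < k := by exact_mod_cast hlt
    have hxX : x ∉ X := by simpa using hx
    have hcard : (insert x X).card = X.card + 1 := Finset.card_insert_of_notMem hxX
    have key : ∃ c, ∀ Y : Finset V, Y.card ≤ 3 * M + 1 →
        ExtendsOver G (Function.update g x c) (insert x X) Y := by
      by_contra! hcon
      have hsmall : ∀ c, ∃ Z : Finset V, Z.card ≤ M ∧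
          ¬ ExtendsOver G (Function.update g x c) (insert x X) Z := by
        intro c
        obtain ⟨Y, hY, hY'⟩ := hcon c
        obtain ⟨Z, hZ, hZ'⟩ := hG.exists_small_obstruction hθ.le Y (by omega) hY'
        refine ⟨Z, ?_, hZ'⟩
        have h1 : ((insert x X).card : ℝ) ≤ k := by
          rw [hcard]
          exact_mod_cast hXk
        have h2 : (3 - θ) * (Z.card : ℝ) ≤ (3 - θ) * M := by linarith
        exact_mod_cast le_of_mul_le_mul_left h2 (by linarith)
      choose Z hZ hZ' using hsmall
      have hbound : (insert x (Finset.univ.biUnion Z)).card ≤ 3 * M + 1 := by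
        refine (Finset.card_insert_le _ _).trans (Nat.add_le_add_right ?_ 1)
        have := Finset.card_biUnion_le_card_mul Finset.univ Z M fun c _ => hZ c
        simpa using this
      obtain ⟨f, hfg, hf⟩ := hX _ hbound
      -- The extension `f` gives `x` some colour, and thereby defeats the obstruction chosen for
      -- that very colour.
      refine hZ' (f x) ⟨f, ?_, ?_⟩
      · intro v hv
        rcases Finset.mem_insert.1 hv with rfl | hv'
        · simp
        · rw [Function.update_of_ne (by rintro rfl; exact hxX hv')]
          exact hfg v hv'
      · have hsub : insert x X ∪ Z (f x) ⊆ X ∪ insert x (Finset.univ.biUnion Z) := by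
          intro v hv
          simp only [Finset.mem_union, Finset.mem_insert, Finset.mem_biUnion, Finset.mem_univ,
            true_and] at hv ⊢
          rcases hv with (h | h) | h
          · exact Or.inr (Or.inl h)
          · exact Or.inl h
          · exact Or.inr (Or.inr ⟨_, h⟩)
        exact fun u hu v hv => hf u (hsub hu) v (hsub hv)
    obtain ⟨c, hc⟩ := key
    refine ⟨restrictTo (Function.update g x c) (insert x X),
      ⟨_, _, rfl, by omega, hc⟩, ?_, ?_⟩
    · intro v a hv
      rw [restrictTo_eq_some] at hv ⊢
      refine ⟨Finset.mem_insert_of_mem hv.1, ?_⟩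
      rw [Function.update_of_ne (by rintro rfl; exact hxX hv.1)]
      exact hv.2
    · rw [dom_restrictTo, dom_restrictTo, Finset.coe_insert]

end Sparse

end LocalConsistency

namespace LocalConsistency

/-! ### Random lists of arcs: independence and local density -/

section Counting

theorem card_filter_forall_mem {ι β : Type*} [Fintype ι] [DecidableEq ι] [Fintype β]
    [DecidableEq β] (T : Finset ι) (E : Finset β)
    [DecidablePred fun f : ι → β => ∀ i ∈ T, f i ∈ E] :
    (Finset.univ.filter fun f : ι → β => ∀ i ∈ T, f i ∈ E).card =
      E.card ^ T.card * Fintype.card β ^ (Fintype.card ι - T.card) := by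
  have : (Finset.univ.filter fun f : ι → β => ∀ i ∈ T, f i ∈ E) =
      Fintype.piFinset fun i => if i ∈ T then E else Finset.univ := by
    ext f
    simp only [Finset.mem_filter, Finset.mem_univ, true_and, Fintype.mem_piFinset]
    refine forall_congr' fun i => ?_
    by_cases hi : i ∈ T <;> simp [hi]
  rw [this, Fintype.card_piFinset]
  simp only [apply_ite Finset.card, Finset.card_univ]
  rw [Finset.prod_ite, Finset.prod_const, Finset.prod_const]
  congr 2
  · congr 1
    ext i
    simp
  · rw [← Finset.card_compl]
    congr 1
    ext i
    simp

theorem choose_le_exp_mul_div_pow (n s : ℕ) (hs : 0 < s) :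
    (n.choose s : ℝ) ≤ (Real.exp 1 * n / s) ^ s := by
  have hs0 : (0 : ℝ) < s := by exact_mod_cast hs
  have hf : (0 : ℝ) < s.factorial := by exact_mod_cast s.factorial_pos
  have h1 : (s : ℝ) ^ s ≤ Real.exp 1 ^ s * s.factorial := by
    have := Real.pow_div_factorial_le_exp (s : ℝ) hs0.le s
    rwa [div_le_iff₀ hf, ← Real.exp_one_pow] at this
  refine (Nat.choose_le_pow_div s n).trans ?_
  rw [div_pow, mul_pow, div_le_div_iff₀ hf (by positivity)]
  calc (n : ℝ) ^ s * (s : ℝ) ^ s ≤ (n : ℝ) ^ s * (Real.exp 1 ^ s * s.factorial) := by gcongr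
    _ = _ := by ring

/-- The left side is the union bound for some `s`-set to contain `t` of `m` random arcs. With `x = e
* m * s / n ^ 2` it is at most `(e * n / s * x ^ c) ^ s`, whose base is increasing in `s`, so the
hypotheses need only treat `s = L`. -/
theorem choose_mul_choose_mul_pow_le {n m s t L : ℕ} {c : ℝ} (hn : 0 < n) (hs : 0 < s) (hsL : s ≤ L)
    (hc : 1 ≤ c) (ht : c * s ≤ t) (hx : Real.exp 1 * m * L / n ^ 2 ≤ 1)
    (hy : Real.exp 1 ^ 2 * m / n * (Real.exp 1 * m * L / n ^ 2) ^ (c - 1) ≤ 1 / 4) :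
    (n.choose s : ℝ) * m.choose t * ((s : ℝ) ^ 2 / n ^ 2) ^ t ≤ (1 / 4) ^ s := by
  have hs0 : (0 : ℝ) < s := by exact_mod_cast hs
  have hn0 : (0 : ℝ) < n := by exact_mod_cast hn
  have hst : (s : ℝ) ≤ t := by nlinarith
  have ht0 : 0 < t := hs.trans_le (by exact_mod_cast hst)
  have hsL' : (s : ℝ) ≤ L := by exact_mod_cast hsL
  set x : ℝ := Real.exp 1 * m * s / n ^ 2 with hxdef
  have hx0 : 0 ≤ x := by positivity
  have hxL : x ≤ Real.exp 1 * m * L / n ^ 2 := by rw [hxdef]; gcongr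
  have h1 : (m.choose t : ℝ) * ((s : ℝ) ^ 2 / n ^ 2) ^ t ≤ x ^ t := by
    calc (m.choose t : ℝ) * ((s : ℝ) ^ 2 / n ^ 2) ^ t
        ≤ (Real.exp 1 * m / t) ^ t * ((s : ℝ) ^ 2 / n ^ 2) ^ t := by
          gcongr
          exact choose_le_exp_mul_div_pow m t ht0
      _ ≤ (Real.exp 1 * m / s) ^ t * ((s : ℝ) ^ 2 / n ^ 2) ^ t := by gcongr
      _ = x ^ t := by
          rw [← mul_pow, hxdef]
          congr 1
          field_simp
  rcases hx0.eq_or_lt with hx00 | hxpos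
  · rw [← hx00, zero_pow ht0.ne'] at h1
    have h0 : (m.choose t : ℝ) * ((s : ℝ) ^ 2 / n ^ 2) ^ t = 0 := le_antisymm h1 (by positivity)
    rw [mul_assoc, h0, mul_zero]
    positivity
  have h2 : x ^ t ≤ (x ^ c) ^ s := by
    rw [← Real.rpow_natCast x t, ← Real.rpow_natCast (x ^ c) s, ← Real.rpow_mul hx0]
    exact Real.rpow_le_rpow_of_exponent_ge hxpos (hxL.trans hx) ht
  have h3 : Real.exp 1 * n / s * x ^ c ≤ 1 / 4 := by
    have : x ^ c = x * x ^ (c - 1) := by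
      rw [← Real.rpow_one_add' hx0 (by linarith)]
      congr 1
      ring
    rw [this]
    calc Real.exp 1 * n / s * (x * x ^ (c - 1))
        = Real.exp 1 ^ 2 * m / n * x ^ (c - 1) := by
          rw [hxdef]
          field_simp
      _ ≤ Real.exp 1 ^ 2 * m / n * (Real.exp 1 * m * L / n ^ 2) ^ (c - 1) := by
          gcongr
      _ ≤ 1 / 4 := hy
  calc (n.choose s : ℝ) * m.choose t * ((s : ℝ) ^ 2 / n ^ 2) ^ t
      = n.choose s * (m.choose t * ((s : ℝ) ^ 2 / n ^ 2) ^ t) := by ring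
    _ ≤ (Real.exp 1 * n / s) ^ s * (x ^ c) ^ s := by
        gcongr
        · exact choose_le_exp_mul_div_pow n s hs
        · exact h1.trans h2
    _ = (Real.exp 1 * n / s * x ^ c) ^ s := by rw [mul_pow]
    _ ≤ (1 / 4) ^ s := by gcongr

/-- Maps `Fin m → Fin n × Fin n`, that is lists of `m` arcs, for which some `a`-set spans no arc. -/
theorem card_exists_independent_le {n m a : ℕ} (hn : 0 < n) (ha : 0 < a)
    (h : Real.log n + 2 ≤ m * (a - 1) / n ^ 2) :
    ((Finset.univ.filter fun f : Fin m → Fin n × Fin n =>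
      ∃ A : Finset (Fin n), A.card = a ∧ ∀ i, f i ∉ A.offDiag).card : ℝ) ≤
      1 / 4 * ((n : ℝ) ^ 2) ^ m := by
  have hn0 : (0 : ℝ) < n := by exact_mod_cast hn
  have hsub : (Finset.univ.filter fun f : Fin m → Fin n × Fin n =>
      ∃ A : Finset (Fin n), A.card = a ∧ ∀ i, f i ∉ A.offDiag) ⊆
      (Finset.univ.powersetCard a).biUnion fun A : Finset (Fin n) =>
        Finset.univ.filter fun f : Fin m → Fin n × Fin n =>
          ∀ i ∈ Finset.univ, f i ∈ A.offDiagᶜ := by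
    intro f hf
    simp only [Finset.mem_filter, Finset.mem_univ, true_and, Finset.mem_biUnion,
      Finset.mem_powersetCard, Finset.subset_univ, Finset.mem_compl, forall_true_left] at hf ⊢
    exact hf
  by_cases han : a ≤ n
  swap
  · have hempty : (Finset.univ : Finset (Fin n)).powersetCard a = ∅ := by
      rw [Finset.powersetCard_eq_empty]
      simpa using han
    rw [hempty, Finset.biUnion_empty, Finset.subset_empty] at hsub
    rw [hsub]
    simp only [Finset.card_empty, Nat.cast_zero]
    positivity
  have han' : (a : ℝ) ≤ n := by exact_mod_cast han
  have ha1 : (1 : ℝ) ≤ a := by exact_mod_cast ha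
  have hcard : ∀ A ∈ (Finset.univ : Finset (Fin n)).powersetCard a,
      (Finset.univ.filter fun f : Fin m → Fin n × Fin n =>
        ∀ i ∈ Finset.univ, f i ∈ A.offDiagᶜ).card ≤ (n * n - (a * a - a)) ^ m := by
    intro A hA
    rw [card_filter_forall_mem, Finset.card_compl, Finset.offDiag_card,
      (Finset.mem_powersetCard.1 hA).2]
    simp
  have h1 := (Finset.card_le_card hsub).trans (Finset.card_biUnion_le_card_mul _ _ _ hcard)
  rw [Finset.card_powersetCard, Finset.card_univ, Fintype.card_fin] at h1
  have h2 : ((n * n - (a * a - a) : ℕ) : ℝ) = (n : ℝ) ^ 2 * (1 - a * (a - 1) / n ^ 2) := by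
    rw [Nat.cast_sub ((Nat.sub_le _ _).trans (Nat.mul_le_mul han han)),
      Nat.cast_sub (Nat.le_mul_self a)]
    push_cast
    field_simp
  have h0 : 0 ≤ 1 - (a : ℝ) * (a - 1) / n ^ 2 := by
    rw [sub_nonneg, div_le_one (by positivity)]
    nlinarith
  calc _ ≤ ((n.choose a * (n * n - (a * a - a)) ^ m : ℕ) : ℝ) := by exact_mod_cast h1
    _ = n.choose a * (1 - a * (a - 1) / n ^ 2) ^ m * ((n : ℝ) ^ 2) ^ m := by
        rw [Nat.cast_mul, Nat.cast_pow, h2, mul_pow]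
        ring
    _ ≤ 1 / 4 * ((n : ℝ) ^ 2) ^ m := by
        gcongr
        -- Bounding the binomial by `n ^ a` and using `1 - y ≤ exp (-y)`, hypothesis `h` leaves at
        -- most `exp (-2 * a)`.
        calc (n.choose a : ℝ) * (1 - a * (a - 1) / n ^ 2) ^ m
            ≤ Real.exp (a * Real.log n) * Real.exp (-(a * (a - 1) / n ^ 2)) ^ m := by
              gcongr
              · rw [Real.exp_nat_mul, Real.exp_log hn0]
                exact_mod_cast Nat.choose_le_pow n a
              · have := Real.add_one_le_exp (-((a : ℝ) * (a - 1) / n ^ 2))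
                linarith
          _ = Real.exp (a * Real.log n - a * (m * (a - 1) / n ^ 2)) := by
              rw [← Real.exp_nat_mul, ← Real.exp_add]
              congr 1
              ring
          _ ≤ Real.exp (-2) := by
              apply Real.exp_le_exp.2
              nlinarith
          _ ≤ 1 / 4 := by
              have h3 : (2 : ℝ) ≤ Real.exp 1 := by have := Real.add_one_le_exp (1 : ℝ); linarith
              have h4 : Real.exp 2 = Real.exp 1 * Real.exp 1 := by
                rw [← Real.exp_add]; norm_num
              rw [Real.exp_neg, one_div]
              gcongr
              nlinarith

theorem sum_Icc_quarter_pow_le (L : ℕ) : ∑ s ∈ Finset.Icc 1 L, (1 / 4 : ℝ) ^ s ≤ 1 / 2 := by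
  have : ∀ L : ℕ, ∑ s ∈ Finset.Icc 1 L, (1 / 4 : ℝ) ^ s ≤ 1 / 2 - 1 / 2 * (1 / 4) ^ L := by
    intro L
    induction L with
    | zero => simp
    | succ L ih =>
      rw [Finset.sum_Icc_succ_top (by omega), pow_succ]
      have : (0 : ℝ) < (1 / 4) ^ L := by positivity
      linarith
  have h := this L
  have : (0 : ℝ) < (1 / 4) ^ L := by positivity
  linarith

theorem card_exists_dense_le {n m L : ℕ} {c : ℝ} (hn : 0 < n) (hc : 1 ≤ c)
    (hx : Real.exp 1 * m * L / n ^ 2 ≤ 1)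
    (hy : Real.exp 1 ^ 2 * m / n * (Real.exp 1 * m * L / n ^ 2) ^ (c - 1) ≤ 1 / 4) :
    ((Finset.univ.filter fun f : Fin m → Fin n × Fin n =>
      ∃ Y : Finset (Fin n), 0 < Y.card ∧ Y.card ≤ L ∧
        c * Y.card ≤ (Finset.univ.filter fun i => f i ∈ Y ×ˢ Y).card).card : ℝ) ≤
      1 / 2 * ((n : ℝ) ^ 2) ^ m := by
  have hn0 : (0 : ℝ) < n := by exact_mod_cast hn
  let B : ℕ → Finset (Fin m → Fin n × Fin n) := fun s =>
    ((Finset.univ.powersetCard s) ×ˢ (Finset.univ.powersetCard ⌈c * s⌉₊)).biUnion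
      fun p : Finset (Fin n) × Finset (Fin m) =>
        Finset.univ.filter fun f : Fin m → Fin n × Fin n => ∀ i ∈ p.2, f i ∈ p.1 ×ˢ p.1
  have hsub : (Finset.univ.filter fun f : Fin m → Fin n × Fin n =>
      ∃ Y : Finset (Fin n), 0 < Y.card ∧ Y.card ≤ L ∧
        c * Y.card ≤ (Finset.univ.filter fun i => f i ∈ Y ×ˢ Y).card) ⊆
      (Finset.Icc 1 L).biUnion B := by
    intro f hf
    simp only [Finset.mem_filter, Finset.mem_univ, true_and] at hf
    obtain ⟨Y, hY0, hYL, hY⟩ := hf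
    obtain ⟨T, hT, hTc⟩ := Finset.exists_subset_card_eq (Nat.ceil_le.2 hY)
    refine Finset.mem_biUnion.2 ⟨Y.card, Finset.mem_Icc.2 ⟨hY0, hYL⟩,
      Finset.mem_biUnion.2 ⟨(Y, T), ?_, ?_⟩⟩
    · simp [Finset.mem_product, Finset.mem_powersetCard, hTc]
    · rw [Finset.mem_filter]
      exact ⟨Finset.mem_univ _, fun i hi => (Finset.mem_filter.1 (hT hi)).2⟩
  have hB : ∀ s ∈ Finset.Icc 1 L, ((B s).card : ℝ) ≤ (1 / 4) ^ s * ((n : ℝ) ^ 2) ^ m := by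
    intro s hs
    obtain ⟨hs1, hsL⟩ := Finset.mem_Icc.1 hs
    set t := ⌈c * s⌉₊ with ht
    have hcard : (B s).card ≤ n.choose s * m.choose t * ((s * s) ^ t * (n * n) ^ (m - t)) := by
      refine (Finset.card_biUnion_le_card_mul _ _ ((s * s) ^ t * (n * n) ^ (m - t)) ?_).trans_eq ?_
      · rintro ⟨Y, T⟩ hp
        simp only [Finset.mem_product, Finset.mem_powersetCard, Finset.subset_univ, true_and] at hp
        dsimp only
        rw [card_filter_forall_mem, Finset.card_product, hp.1, hp.2]
        simp [ht]
      · simp [ht, Finset.card_product, Finset.card_powersetCard]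
    by_cases htm : t ≤ m
    · have hkey := choose_mul_choose_mul_pow_le hn hs1 hsL hc (Nat.le_ceil (c * s)) hx hy
      rw [← ht] at hkey
      calc ((B s).card : ℝ)
          ≤ ((n.choose s * m.choose t * ((s * s) ^ t * (n * n) ^ (m - t)) : ℕ) : ℝ) := by
            exact_mod_cast hcard
        _ = n.choose s * m.choose t * ((s : ℝ) ^ 2 / n ^ 2) ^ t * ((n : ℝ) ^ 2) ^ m := by
            have : ((n : ℝ) ^ 2) ^ m = ((n : ℝ) ^ 2) ^ t * ((n : ℝ) ^ 2) ^ (m - t) := by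
              rw [← pow_add, Nat.add_sub_cancel' htm]
            rw [this, div_pow]
            push_cast
            field_simp
        _ ≤ _ := by gcongr
    · rw [Nat.choose_eq_zero_of_lt (not_le.1 htm), mul_zero, zero_mul, Nat.le_zero] at hcard
      rw [hcard, Nat.cast_zero]
      positivity
  calc _ ≤ (((Finset.Icc 1 L).biUnion B).card : ℝ) := by exact_mod_cast Finset.card_le_card hsub
    _ ≤ ∑ s ∈ Finset.Icc 1 L, ((B s).card : ℝ) := by exact_mod_cast Finset.card_biUnion_le
    _ ≤ ∑ s ∈ Finset.Icc 1 L, (1 / 4) ^ s * ((n : ℝ) ^ 2) ^ m := Finset.sum_le_sum hB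
    _ = (∑ s ∈ Finset.Icc 1 L, (1 / 4 : ℝ) ^ s) * ((n : ℝ) ^ 2) ^ m := by rw [Finset.sum_mul]
    _ ≤ _ := by
        gcongr
        exact sum_Icc_quarter_pow_le L

/-- The simple graph underlying a list of arcs. -/
def arcGraph {n m : ℕ} (f : Fin m → Fin n × Fin n) : SimpleGraph (Fin n) :=
  SimpleGraph.fromRel fun u v => ∃ i, f i = (u, v)

/-- Each arc, read in its two directions, covers all adjacent ordered pairs; loops and repeated arcs
only help. -/
theorem sum_degree_arcGraph_le {n m : ℕ} (f : Fin m → Fin n × Fin n)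
    [DecidableRel (arcGraph f).Adj] (Y : Finset (Fin n)) :
    ∑ y ∈ Y, (Y.filter ((arcGraph f).Adj y)).card ≤
      2 * (Finset.univ.filter fun i => f i ∈ Y ×ˢ Y).card := by
  rw [← Finset.card_sigma, mul_comm]
  have hb : (Finset.univ : Finset Bool).card = 2 := by simp
  rw [← hb, ← Finset.card_product]
  refine Finset.card_le_card_of_surjOn
    (fun p => if p.2 then ⟨(f p.1).1, (f p.1).2⟩ else ⟨(f p.1).2, (f p.1).1⟩) ?_
  rintro ⟨u, v⟩ huv
  simp only [Finset.coe_sigma, Set.mem_sigma_iff, Finset.mem_coe, Finset.mem_filter] at huv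
  obtain ⟨hu, hv, -, ⟨i, hi⟩ | ⟨i, hi⟩⟩ := huv
  · exact ⟨(i, true), by simp [hi, hu, hv], by simp [hi]⟩
  · exact ⟨(i, false), by simp [hi, hu, hv], by simp [hi]⟩

/-- A graph without large independent sets all of whose small subgraphs are sparse. -/
theorem exists_sparse_graph {n m a L : ℕ} {c : ℝ} (hn : 0 < n) (ha : 0 < a) (hc : 1 ≤ c)
    (h : Real.log n + 2 ≤ m * (a - 1) / n ^ 2)
    (hx : Real.exp 1 * m * L / n ^ 2 ≤ 1)
    (hy : Real.exp 1 ^ 2 * m / n * (Real.exp 1 * m * L / n ^ 2) ^ (c - 1) ≤ 1 / 4) :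
    ∃ (G : SimpleGraph (Fin n)) (_ : DecidableRel G.Adj),
      (∀ A : Finset (Fin n), a ≤ A.card → ∃ u ∈ A, ∃ v ∈ A, G.Adj u v) ∧
      LocallySparse G L (2 * c) := by
  classical
  have hn0 : (0 : ℝ) < n := by exact_mod_cast hn
  have h1 := card_exists_independent_le hn ha h
  have h2 := card_exists_dense_le hn hc hx hy
  set B₁ := (Finset.univ.filter fun f : Fin m → Fin n × Fin n =>
      ∃ A : Finset (Fin n), A.card = a ∧ ∀ i, f i ∉ A.offDiag) with hB₁
  set B₂ := (Finset.univ.filter fun f : Fin m → Fin n × Fin n =>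
      ∃ Y : Finset (Fin n), 0 < Y.card ∧ Y.card ≤ L ∧
        c * Y.card ≤ (Finset.univ.filter fun i => f i ∈ Y ×ˢ Y).card) with hB₂
  -- The two bad events have proportions at most `1 / 4` and `1 / 2`.
  have hlt : (B₁ ∪ B₂).card < (Finset.univ : Finset (Fin m → Fin n × Fin n)).card := by
    have hcard : ((Finset.univ : Finset (Fin m → Fin n × Fin n)).card : ℝ) =
        ((n : ℝ) ^ 2) ^ m := by
      simp [Finset.card_univ, pow_two]
    have hle : ((B₁ ∪ B₂).card : ℝ) ≤ B₁.card + B₂.card := by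
      exact_mod_cast Finset.card_union_le _ _
    have hpos : 0 < ((n : ℝ) ^ 2) ^ m := by positivity
    have : ((B₁ ∪ B₂).card : ℝ) < (Finset.univ : Finset (Fin m → Fin n × Fin n)).card := by
      rw [hcard]
      linarith
    exact_mod_cast this
  obtain ⟨f, -, hf⟩ := Finset.exists_mem_notMem_of_card_lt_card hlt
  simp only [hB₁, hB₂, Finset.mem_union, Finset.mem_filter, Finset.mem_univ, true_and, not_or,
    not_exists, not_and, not_forall, not_not, not_le] at hf
  obtain ⟨hf1, hf2⟩ := hf
  refine ⟨arcGraph f, inferInstance, ?_, ?_⟩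
  · intro A hA
    obtain ⟨A', hA', hcA'⟩ := Finset.exists_subset_card_eq hA
    obtain ⟨i, hi⟩ := hf1 A' hcA'
    rw [Finset.mem_offDiag] at hi
    exact ⟨_, hA' hi.1, _, hA' hi.2.1, hi.2.2, Or.inl ⟨i, rfl⟩⟩
  · intro Y hY
    rcases Y.eq_empty_or_nonempty with rfl | hne
    · simp
    · have h3 := hf2 Y hne.card_pos hY
      have h4 : (∑ y ∈ Y, ((Y.filter ((arcGraph f).Adj y)).card : ℝ)) ≤
          2 * (Finset.univ.filter fun i => f i ∈ Y ×ˢ Y).card := by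
        exact_mod_cast sum_degree_arcGraph_le f Y
      linarith

end Counting

end LocalConsistency

namespace LocalConsistency

/-! ### Choice of parameters and asymptotic estimates -/

section Asymptotic

theorem eventually_log_add_le_rpow {δ : ℝ} (hδ : 0 < δ) {C : ℝ} (hC : 0 < C) :
    ∀ᶠ n : ℕ in atTop, Real.log n + 3 ≤ C * (n : ℝ) ^ δ := by
  have h1 := ((isLittleO_log_rpow_atTop hδ).bound (half_pos hC)).and
    ((tendsto_rpow_atTop hδ).eventually_ge_atTop (6 / C))
  filter_upwards [tendsto_natCast_atTop_atTop.eventually h1] with n hn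
  obtain ⟨h2, h3⟩ := hn
  rw [Real.norm_of_nonneg (Real.rpow_nonneg (Nat.cast_nonneg _) _)] at h2
  have h4 := (le_abs_self _).trans h2
  rw [div_le_iff₀ hC] at h3
  linarith

theorem eventually_mul_rpow_neg_le {β : ℝ} (hβ : β < 0) (A : ℝ) {b : ℝ} (hb : 0 < b) :
    ∀ᶠ n : ℕ in atTop, A * (n : ℝ) ^ β ≤ b := by
  have h := (tendsto_rpow_neg_atTop (neg_pos.2 hβ)).const_mul A
  rw [neg_neg, mul_zero] at h
  exact (h.comp tendsto_natCast_atTop_atTop).eventually_le_const hb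

theorem not_colorable_of_forall_exists_adj {V : Type*} [Fintype V] {G : SimpleGraph V} {a r : ℕ}
    (hG : ∀ A : Finset V, a ≤ A.card → ∃ u ∈ A, ∃ v ∈ A, G.Adj u v)
    (hr : 0 < r) (ha : ∀ b : ℕ, Fintype.card V ≤ r * b → a ≤ b) : ¬ G.Colorable r := by
  classical
  rintro ⟨C⟩
  have : Nonempty (Fin r) := ⟨⟨0, hr⟩⟩
  obtain ⟨i, -, hi⟩ := Finset.exists_max_image (Finset.univ : Finset (Fin r))
    (fun i => (Finset.univ.filter fun v => C v = i).card) Finset.univ_nonempty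
  have hcard : Fintype.card V ≤ r * (Finset.univ.filter fun v => C v = i).card := by
    rw [← Finset.card_univ, Finset.card_eq_sum_card_fiberwise (f := C) (t := Finset.univ)
      (fun v _ => Finset.mem_coe.2 (Finset.mem_univ _))]
    refine (Finset.sum_le_sum hi).trans_eq ?_
    simp
  obtain ⟨u, hu, v, hv, huv⟩ := hG _ (ha _ hcard)
  simp only [Finset.mem_filter, Finset.mem_univ, true_and] at hu hv
  exact C.valid huv (hu.trans hv.symm)

theorem eventually_exists_consistentLE_not_colorable {ε γ : ℝ} (hε0 : 0 < ε) (hγ0 : 0 < γ)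
    (hγ : γ < 1 - 3 * ε) (q k : ℕ → ℕ) (hq3 : ∀ n, 1 ≤ n → 3 ≤ q n)
    (hq : (fun n => (q n : ℝ)) =O[atTop] (fun n : ℕ => (n : ℝ) ^ ε))
    (hk : (fun n => (k n : ℝ)) =O[atTop] (fun n : ℕ => (n : ℝ) ^ γ)) :
    ∀ᶠ n in atTop, ∃ G : SimpleGraph (Fin n),
      ConsistentLE (k n) G (SimpleGraph.completeGraph (Fin 3)) ∧ ¬ G.Colorable (q n) := by
  obtain ⟨C, hC0, hC⟩ := hq.exists_pos
  obtain ⟨B, hB0, hB⟩ := hk.exists_pos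
  rw [IsBigOWith] at hC hB
  obtain ⟨δ, hδ, hδD⟩ : ∃ δ : ℝ, 0 < δ ∧ 12 * δ = 1 - 3 * ε - γ :=
    ⟨(1 - 3 * ε - γ) / 12, by linarith, by ring⟩
  set c : ℝ := 3 / 2 - δ with hc
  have hδ1 : δ < 1 / 12 := by linarith
  set A : ℝ := (9 / (2 * δ) + 1) * B + 4 with hA
  have hA0 : 0 < A := by positivity
  set X : ℝ := Real.exp 1 * 2 * A with hX
  have hX0 : 0 < X := by positivity
  have hα : ε + δ + γ - 1 < 0 := by linarith
  -- This is where `γ < 1 - 3 * ε` enters: at `c = 3 / 2` and `δ = 0` the exponent would be `(3 * ε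
  -- + γ - 1) / 2`, and the factor 12 in the choice of `δ` absorbs the perturbation.
  have hβ : ε + δ + (ε + δ + γ - 1) * (c - 1) < 0 := by
    rw [hc]
    nlinarith
  filter_upwards [hC, hB, eventually_ge_atTop 1,
    eventually_log_add_le_rpow hδ (one_div_pos.2 hC0), eventually_mul_rpow_neg_le hα X one_pos,
    eventually_mul_rpow_neg_le hβ (2 * Real.exp 1 ^ 2 * X ^ (c - 1)) (b := 1 / 4) (by norm_num)]
    with n hqn hkn hn1 hlog hxn hyn
  have hn1' : (1 : ℝ) ≤ n := by exact_mod_cast hn1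
  have hn0 : (0 : ℝ) < n := by linarith
  rw [Real.norm_of_nonneg (Nat.cast_nonneg _),
    Real.norm_of_nonneg (Real.rpow_nonneg hn0.le _)] at hqn hkn
  -- With `θ = 2 * c` one has `3 - θ = 2 * δ`. Below, `m` is large enough for `m * a / n ^ 2` to be
  -- at least `n ^ δ / C`, and `a` is a lower bound for the largest class of a `q n`-colouring.
  set M := ⌈3 * (k n : ℝ) / (2 * δ)⌉₊ with hM
  set L := 3 * M + 1 + k n with hL
  set m := ⌈(n : ℝ) ^ (1 + ε + δ)⌉₊ with hm
  set a := ⌈(n : ℝ) ^ (1 - ε) / C⌉₊ with ha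
  have hpow : ∀ x : ℝ, 0 < (n : ℝ) ^ x := fun x => Real.rpow_pos_of_pos hn0 x
  have hpow1 : ∀ x : ℝ, 0 ≤ x → 1 ≤ (n : ℝ) ^ x := fun x hx => Real.one_le_rpow hn1' hx
  have hadd : ∀ x y : ℝ, (n : ℝ) ^ (x + y) = (n : ℝ) ^ x * (n : ℝ) ^ y := Real.rpow_add hn0
  have hsq : (n : ℝ) ^ 2 = (n : ℝ) ^ (2 : ℝ) := by norm_cast
  have hMle : (M : ℝ) ≤ 3 * (k n : ℝ) / (2 * δ) + 1 := (Nat.ceil_lt_add_one (by positivity)).le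
  have hMge : 3 * (k n : ℝ) ≤ (3 - 2 * c) * M := by
    have := Nat.le_ceil (3 * (k n : ℝ) / (2 * δ))
    rw [div_le_iff₀ (by positivity), ← hM] at this
    rw [hc]
    linarith
  have hLle : (L : ℝ) ≤ A * (n : ℝ) ^ γ := by
    have h1 := hpow1 γ hγ0.le
    calc (L : ℝ) = 3 * M + 1 + k n := by rw [hL]; push_cast; ring
      _ ≤ 3 * (3 * (k n : ℝ) / (2 * δ) + 1) + 1 + k n := by gcongr
      _ = (9 / (2 * δ) + 1) * k n + 4 := by ring
      _ ≤ (9 / (2 * δ) + 1) * (B * (n : ℝ) ^ γ) + 4 * (n : ℝ) ^ γ := by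
          gcongr
          linarith
      _ = A * (n : ℝ) ^ γ := by rw [hA]; ring
  have hmge : (n : ℝ) ^ (1 + ε + δ) ≤ m := Nat.le_ceil _
  have hmle : (m : ℝ) ≤ 2 * (n : ℝ) ^ (1 + ε + δ) := by
    have h1 := hpow1 (1 + ε + δ) (by linarith)
    have h2 := (Nat.ceil_lt_add_one (hpow (1 + ε + δ)).le).le
    rw [← hm] at h2
    linarith
  have hage : (n : ℝ) ^ (1 - ε) / C ≤ a := Nat.le_ceil _
  have ha0 : 0 < a := Nat.ceil_pos.2 (div_pos (hpow _) hC0)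
  have ha1 : (1 : ℝ) ≤ a := by exact_mod_cast ha0
  have hc1 : 0 ≤ c - 1 := by rw [hc]; linarith
  have hcond : Real.log n + 2 ≤ m * (a - 1) / n ^ 2 := by
    calc Real.log n + 2 ≤ 1 / C * (n : ℝ) ^ δ - (n : ℝ) ^ (ε + δ - 1) := by
          have : (n : ℝ) ^ (ε + δ - 1) ≤ 1 :=
            Real.rpow_le_one_of_one_le_of_nonpos hn1' (by linarith)
          linarith
      _ = (n : ℝ) ^ (1 + ε + δ) * ((n : ℝ) ^ (1 - ε) / C - 1) / n ^ 2 := by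
          rw [eq_div_iff (by positivity), hsq, sub_mul, mul_assoc, ← hadd, ← hadd, mul_sub,
            mul_div_assoc', ← hadd, mul_one]
          ring_nf
      _ ≤ (n : ℝ) ^ (1 + ε + δ) * (a - 1) / n ^ 2 := by gcongr
      _ ≤ m * (a - 1) / n ^ 2 := by
          have : (0 : ℝ) ≤ a - 1 := by linarith
          gcongr
  have hxle : Real.exp 1 * m * L / n ^ 2 ≤ X * (n : ℝ) ^ (ε + δ + γ - 1) := by
    calc Real.exp 1 * m * L / n ^ 2
        ≤ Real.exp 1 * (2 * (n : ℝ) ^ (1 + ε + δ)) * (A * (n : ℝ) ^ γ) / n ^ 2 := by gcongr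
      _ = X * (n : ℝ) ^ (ε + δ + γ - 1) := by
          rw [div_eq_iff (by positivity), hsq, mul_assoc X, ← hadd,
            show ε + δ + γ - 1 + 2 = 1 + ε + δ + γ by ring, hadd (1 + ε + δ), hX]
          ring
  have hyle : Real.exp 1 ^ 2 * m / n * (Real.exp 1 * m * L / n ^ 2) ^ (c - 1) ≤ 1 / 4 := by
    refine le_trans ?_ hyn
    calc Real.exp 1 ^ 2 * m / n * (Real.exp 1 * m * L / n ^ 2) ^ (c - 1)
        ≤ Real.exp 1 ^ 2 * (2 * (n : ℝ) ^ (1 + ε + δ)) / n *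
          (X * (n : ℝ) ^ (ε + δ + γ - 1)) ^ (c - 1) := by gcongr
      _ = 2 * Real.exp 1 ^ 2 * X ^ (c - 1) *
          (n : ℝ) ^ (ε + δ + (ε + δ + γ - 1) * (c - 1)) := by
          rw [Real.mul_rpow hX0.le (hpow _).le, ← Real.rpow_mul hn0.le, hadd (ε + δ),
            show 1 + ε + δ = 1 + (ε + δ) by ring, hadd 1, Real.rpow_one]
          field_simp
  obtain ⟨G, hdec, hind, hsparse⟩ := exists_sparse_graph hn1 ha0 (by linarith) hcond
    (hxle.trans hxn) hyle
  refine ⟨G, hsparse.consistentLE (by rw [hc]; linarith) hMge le_rfl, ?_⟩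
  have hq0 : 0 < q n := by have := hq3 n hn1; omega
  refine not_colorable_of_forall_exists_adj hind hq0 fun b hb => ?_
  rw [Fintype.card_fin] at hb
  rw [ha, Nat.ceil_le, div_le_iff₀ hC0]
  have hb' : (n : ℝ) ≤ q n * b := by exact_mod_cast hb
  have h1 : (n : ℝ) ≤ C * (n : ℝ) ^ ε * b := hb'.trans (by gcongr)
  have h2 : (n : ℝ) = (n : ℝ) ^ (1 - ε) * (n : ℝ) ^ ε := by
    rw [← hadd, sub_add_cancel, Real.rpow_one]
  have h3 : (n : ℝ) ^ (1 - ε) * (n : ℝ) ^ ε ≤ b * C * (n : ℝ) ^ ε := by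
    rw [← h2]
    linarith
  exact le_of_mul_le_mul_right h3 (hpow ε)

theorem consistentLE_zero {V W : Type*} (G : SimpleGraph V) (H : SimpleGraph W) :
    ConsistentLE 0 G H := by
  refine ⟨{fun _ => none}, Set.singleton_nonempty _, ?_, ?_, ?_⟩
  · rintro h rfl u v a b hu
    cases hu
  · rintro h rfl g hg
    rw [Set.mem_singleton_iff]
    funext v
    cases hv : g v with
    | none => rfl
    | some a => cases hg v a hv
  · intro h _ hlt
    simp at hlt

theorem eventually_eq_zero_of_isBigO_rpow_neg {γ : ℝ} (hγ : γ < 0) (k : ℕ → ℕ)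
    (hk : (fun n => (k n : ℝ)) =O[atTop] (fun n : ℕ => (n : ℝ) ^ γ)) :
    ∀ᶠ n in atTop, k n = 0 := by
  obtain ⟨B, hB⟩ := hk.bound
  filter_upwards [hB, eventually_mul_rpow_neg_le hγ B (b := 1 / 2) (by norm_num)] with n h1 h2
  rw [Real.norm_of_nonneg (Nat.cast_nonneg _),
    Real.norm_of_nonneg (Real.rpow_nonneg (Nat.cast_nonneg _) _)] at h1
  have : (k n : ℝ) < 1 := by linarith
  exact Nat.lt_one_iff.1 (by exact_mod_cast this)

theorem eventually_lt_of_isBigO_rpow {ε : ℝ} (hε : ε < 1) (q : ℕ → ℕ)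
    (hq : (fun n => (q n : ℝ)) =O[atTop] (fun n : ℕ => (n : ℝ) ^ ε)) :
    ∀ᶠ n in atTop, q n < n := by
  obtain ⟨B, hB⟩ := hq.bound
  filter_upwards [hB, eventually_mul_rpow_neg_le (sub_neg.2 hε) B (b := 1 / 2) (by norm_num),
    eventually_ge_atTop 1] with n h1 h2 hn
  have hn0 : (0 : ℝ) < n := by exact_mod_cast hn
  rw [Real.norm_of_nonneg (Nat.cast_nonneg _),
    Real.norm_of_nonneg (Real.rpow_nonneg (Nat.cast_nonneg _) _)] at h1
  rw [Real.rpow_sub_one hn0.ne', mul_div_assoc', div_le_iff₀ hn0] at h2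
  have : (q n : ℝ) < n := by linarith
  exact_mod_cast this

theorem isBigO_rpow_of_le {γ γ' : ℝ} (h : γ ≤ γ') :
    (fun n : ℕ => (n : ℝ) ^ γ) =O[atTop] (fun n : ℕ => (n : ℝ) ^ γ') := by
  refine IsBigO.of_bound 1 ?_
  filter_upwards [eventually_ge_atTop 1] with n hn
  rw [Real.norm_of_nonneg (Real.rpow_nonneg (Nat.cast_nonneg _) _),
    Real.norm_of_nonneg (Real.rpow_nonneg (Nat.cast_nonneg _) _), one_mul]
  exact Real.rpow_le_rpow_of_exponent_le (by exact_mod_cast hn) h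

end Asymptotic

end LocalConsistency

/-! ### The two bounds combined -/

theorem theorem6p3 (ε : ℝ) (hε0 : 0 < ε) (hε1 : ε < 1 / 2)
    (q : ℕ → ℕ) (hq3 : ∀ n, 1 ≤ n → 3 ≤ q n)
    (hqΘ : (fun n => (q n : ℝ)) =Θ[atTop] (fun n : ℕ => (n : ℝ) ^ ε)) :
    (∃ k : ℕ → ℕ, (∀ n, 1 ≤ k n) ∧
      (fun n => (k n : ℝ)) =O[atTop] (fun n : ℕ => (n : ℝ) ^ (1 - 2 * ε)) ∧
      ∀ (V : Type*) [Fintype V] (G : SimpleGraph V),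
        LocalConsistency.ConsistentLE (k (Fintype.card V)) G (SimpleGraph.completeGraph (Fin 3)) →
        Nonempty (G →g SimpleGraph.completeGraph (Fin (q (Fintype.card V))))) ∧
    (∀ γ : ℝ, γ < 1 - 3 * ε → ∀ k : ℕ → ℕ,
      (fun n => (k n : ℝ)) =O[atTop] (fun n : ℕ => (n : ℝ) ^ γ) →
      ∀ N : ℕ, ∃ n, N ≤ n ∧ ∃ G : SimpleGraph (Fin n),
        LocalConsistency.ConsistentLE (k n) G (SimpleGraph.completeGraph (Fin 3)) ∧
        ¬ Nonempty (G →g SimpleGraph.completeGraph (Fin (q n)))) := by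
  refine ⟨LocalConsistency.exists_pebble_number ε hε1 q hq3 hε0 hqΘ.2, fun γ hγ k hk N => ?_⟩
  have hev : ∀ᶠ n in atTop, ∃ G : SimpleGraph (Fin n),
      LocalConsistency.ConsistentLE (k n) G (SimpleGraph.completeGraph (Fin 3)) ∧
        ¬ G.Colorable (q n) := by
    by_cases hε3 : 0 < 1 - 3 * ε
    -- Raising `γ` to a positive value only weakens the bound on `k`, and lets additive constants be
    -- absorbed into `n ^ γ`.
    · refine LocalConsistency.eventually_exists_consistentLE_not_colorable hε0
        (γ := max γ ((1 - 3 * ε) / 2)) (lt_max_of_lt_right (by linarith))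
        (max_lt hγ (by linarith)) q k hq3 hqΘ.1
        (hk.trans (LocalConsistency.isBigO_rpow_of_le (le_max_left _ _)))
    -- If `ε ≥ 1 / 3` then `γ < 0`, so `k n = 0` eventually and the consistency condition is void; a
    -- complete graph suffices.
    · filter_upwards [LocalConsistency.eventually_eq_zero_of_isBigO_rpow_neg (by linarith) k hk,
        LocalConsistency.eventually_lt_of_isBigO_rpow (by linarith) q hqΘ.1] with n hk0 hqn
      refine ⟨SimpleGraph.completeGraph (Fin n), hk0 ▸ LocalConsistency.consistentLE_zero _ _, ?_⟩
      rintro ⟨f⟩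
      have := Fintype.card_le_of_injective f
        (SimpleGraph.Hom.injective_of_top_hom f)
      simp only [Fintype.card_fin] at this
      omega
  obtain ⟨n, ⟨G, hG⟩, hn⟩ := (hev.and (eventually_ge_atTop N)).exists
  exact ⟨n, hn, G, hG⟩
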